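/- **Setting.** Let $\mathcal{X}=\mathbb{R}^d$, $\mathcal{Y}=\{-1,+1\}$, and let $D_X$ be a joint distribution of features $x\in\mathcal{X}$ and a sensitive attribute $x_A\in\{0,1\}$ under which both groups $\{x_A=0\}$ and $\{x_A=1\}$ have positive probability. For a (measurable) classifier $h:\mathcal{X}\to\mathcal{Y}$ let $$\mu(h)=\Pr_{D_X}\bigl(h(x)=1\mid x_A=1\bigr)-\Pr_{D_X}\bigl(h(x)=1\mid x_A=0\bigr).$$ Let $\mathcal{H}_{\mathrm{lin}}=\{h_{a,b}: a\in\mathbb{R}^d,\ b\in\mathbb{R}\}$ with $h_{a,b}(x)=\mathrm{sign}(\langle a,x\rangle+b)$, where $\mathrm{sign}(t)=+1$ if $t\ge 0$ and $-1$ otherwise. A randomized auditing algorithm $\mathcal{A}$ with label budget $N$ and $B$ bits of random seed consists of functions $f_i:(\mathcal{X}\times\mathcal{Y})^{i-1}\times\{0,1\}^B\to\mathcal{X}$ for $1\le i\le N$ and $g:(\mathcal{X}\times\mathcal{Y})^{N}\times\{0,1\}^B\to\mathbb{R}$. (The deterministic algorithms are the case $B=0$.) When it interacts with $h^*$, a seed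 $s$ is drawn uniformly from $\{0,1\}^B$; then for $i=1,\dots,N$ it queries $x_i=f_i\bigl((x_1,y_1),\dots,(x_{i-1},y_{i-1}),s\bigr)$ and receives $y_i=h^*(x_i)$; finally it outputs $\hat\mu=g\bigl((x_1,y_1),\dots,(x_N,y_N),s\bigr)$. **Theorem.** There is a universal constant $c>0$ such that the following holds. Let $d\ge 6400$ and $\epsilon\in(0,\tfrac1{80}]$, and let $D_X$ be such that $x\mid x_A=0\ \sim\ \mathrm{N}(0_d,I_d)$ and $x\mid x_A=1\ \sim\ \mathrm{N}(0_d,0_{d\times d})$, i.e. the point mass at $0_d$. Then for every integer $N\ge 0$ with $N\le c\,\min\bigl(d,\tfrac1{\epsilon^2}\bigr)$, every $B\ge 0$ and every randomized auditing algorithm $\mathcal{A}$ with label budget $N$ and $B$ bits of random seed, there exists $h^*\in\mathcal{H}_{\mathrm{lin}}$ such that the output $\hat\mu$ of $\mathcal{A}$ when interacting with $h^*$ satisfies $$\mathbb{P}_{\mathcal{A},h^*}\bigl(|\hat\mu-\mu(h^*)|>\epsilon\bigr)>\tfrac18 .$$ -/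

import Mathlib

open MeasureTheory ProbabilityTheory

namespace FairAudit

/-- Classifiers on the feature space `X`. The labels `-1, +1` are the elements of `ℤˣ`. -/
abbrev Classifier (X : Type*) := X → ℤˣ

/-- A randomized active auditing algorithm with label budget `N` and `B` bits of random seed:
`query i` selects the next example to be labeled from the `i` labeled examples obtained so far
(`i = 0, …, N - 1`), and `estimate` computes the output from all `N` labeled examples; both may
use the seed. A deterministic algorithm is the case `B = 0`. -/
structure Auditor (X : Type*) (N B : ℕ) where
  query : (i : Fin N) → (Fin i → X × ℤˣ) → (Fin B → Bool) → X
  estimate : (Fin N → X × ℤˣ) → (Fin B → Bool) → ℝ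

namespace Auditor

variable {X : Type*} {N B : ℕ}

/-- The first `i` labeled examples obtained when `A`, run with the seed `s`, queries `h`. -/
def history (A : Auditor X N B) (h : Classifier X) (s : Fin B → Bool) :
    (i : ℕ) → i ≤ N → Fin i → X × ℤˣ
  | 0, _ => Fin.elim0
  | i + 1, hi =>
    let past := A.history h s i (Nat.le_of_succ_le hi)
    let x := A.query ⟨i, hi⟩ past s
    Fin.snoc (α := fun _ => X × ℤˣ) past (x, h x)

/-- The estimate that `A`, run with the seed `s`, outputs after interacting with `h`. -/
def output (A : Auditor X N B) (h : Classifier X) (s : Fin B → Bool) : ℝ :=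
  A.estimate (A.history h s N le_rfl) s

end Auditor

/-- The law of a seed of `B` independent fair bits. -/
noncomputable def seedLaw (B : ℕ) : Measure (Fin B → Bool) :=
  uniformOn Set.univ

/-- The event that a pair (features, sensitive attribute) lies in the group `g`. -/
def group (X : Type*) (g : Fin 2) : Set (X × Fin 2) :=
  {p | p.2 = g}

/-- The conditional law of the features `x` given that the sensitive attribute is `g`. -/
noncomputable def groupLaw {X : Type*} [MeasurableSpace X] (D : Measure (X × Fin 2))
    (g : Fin 2) : Measure X :=
  (D[|group X g]).map Prod.fst

/-- Demographic parity of `h` under the joint distribution `D` of features and sensitive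
attribute: `Pr(h(x) = 1 | x_A = 1) - Pr(h(x) = 1 | x_A = 0)`. -/
noncomputable def demographicParity {X : Type*} [MeasurableSpace X] (D : Measure (X × Fin 2))
    (h : Classifier X) : ℝ :=
  (D[|group X 1]).real {p | h p.1 = 1} - (D[|group X 0]).real {p | h p.1 = 1}

/-- The linear classifier `x ↦ sign(⟨a, x⟩ + b)`, where `sign 0 = +1`. -/
noncomputable def linearClassifier {d : ℕ} (a : EuclideanSpace ℝ (Fin d)) (b : ℝ) :
    Classifier (EuclideanSpace ℝ (Fin d)) :=
  fun x => if 0 ≤ inner ℝ a x + b then 1 else -1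

/-- The class of non-homogeneous linear classifiers on `ℝ^d`. -/
def linearClass (d : ℕ) : Set (Classifier (EuclideanSpace ℝ (Fin d))) :=
  {h | ∃ (a : EuclideanSpace ℝ (Fin d)) (b : ℝ), h = linearClassifier a b}

end FairAudit

/-! Le Cam's two-point method with two Gaussian priors. Fix the bias `1` and draw the weights `a`
from `σ • N(0, I)` or `τ • N(0, I)`. The parity is then `Φ(-1/‖a‖)`, and since `‖a‖` concentrates,
the two priors give parities more than `2ε` apart: an accurate auditor would tell the scales apart.

Labels reveal too little for that. Even if each query disclosed the whole component of `a` along the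
queried direction, it would yield one scalar Gaussian of variance `σ²` or `τ²`, independent of the
orthogonal part. Hence `N` adaptive queries are worth at most `N` independent scalar samples, and
the Bhattacharyya affinity stays at least the `N`-th power of the scalar one
(`IsQueryTree.pow_le_affinity`). With `τ/σ = 1 + O(e)` and `N e²` small, the two error probabilities
sum to at least `9/20` (`IsQueryTree.two_point_bound`), whereas success on every classifier would
make this sum at most `2 (1/8 + 2/25)` (`exists_seedLaw_real_error_gt`). -/

namespace FairAudit

/-! ### Decision trees over halfspace tests -/

section QueryTree

variable {E : Type*} [NormedAddCommGroup E] [InnerProductSpace ℝ E]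

/-- `IsQueryTree n f`: the function `f` with values in `[0, 1]` is computed by a decision tree
of depth `n` whose nodes test the sign of `⟪a, x⟫ + b`. -/
inductive IsQueryTree : ℕ → (E → ℝ) → Prop
  | const {c : ℝ} (h0 : 0 ≤ c) (h1 : c ≤ 1) : IsQueryTree 0 (fun _ => c)
  | query {n : ℕ} {f g : E → ℝ} (x : E) (b : ℝ) (hf : IsQueryTree n f) (hg : IsQueryTree n g) :
      IsQueryTree (n + 1) (fun a => if 0 ≤ inner ℝ a x + b then f a else g a)

namespace IsQueryTree

theorem nonneg {n : ℕ} {f : E → ℝ} (hf : IsQueryTree n f) (a : E) : 0 ≤ f a := by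
  induction hf with
  | const h0 h1 => exact h0
  | query x b _ _ ihf ihg => dsimp only; split_ifs <;> assumption

theorem le_one {n : ℕ} {f : E → ℝ} (hf : IsQueryTree n f) (a : E) : f a ≤ 1 := by
  induction hf with
  | const h0 h1 => exact h1
  | query x b _ _ ihf ihg => dsimp only; split_ifs <;> assumption

theorem measurable [MeasurableSpace E] [BorelSpace E] {n : ℕ} {f : E → ℝ}
    (hf : IsQueryTree n f) : Measurable f := by
  induction hf with
  | const h0 h1 => exact measurable_const
  | query x b _ _ ihf ihg =>
    refine Measurable.ite ?_ ihf ihg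
    exact (isClosed_le continuous_const (by fun_prop)).measurableSet

/-- The adjoint of `L` moves into the query and `v` into the bias. This keeps a tree with one
component of `a` frozen a tree on the same space, so the induction never lowers the dimension. -/
theorem comp_affine [CompleteSpace E] {n : ℕ} {f : E → ℝ} (hf : IsQueryTree n f) (v : E)
    (L : E →L[ℝ] E) : IsQueryTree n (fun a => f (v + L a)) := by
  induction hf with
  | const h0 h1 => exact const h0 h1
  | query x b _ _ ihf ihg =>
    convert query (ContinuousLinearMap.adjoint L x) (inner ℝ v x + b) ihf ihg using 3 with a
    rw [ContinuousLinearMap.adjoint_inner_right, inner_add_left]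
    congr! 1
    ring

end IsQueryTree

end QueryTree

/-! ### Auditors as query trees -/

section Auditor

variable {d N B : ℕ}

/-- Histories grow at the end while trees grow at the root, hence the arbitrary continuation `F`:
the induction absorbs the last query into it, raising its depth by one. -/
theorem isQueryTree_history_bind (A : Auditor (EuclideanSpace ℝ (Fin d)) N B) (s : Fin B → Bool)
    (β : ℝ) (i : ℕ) (hi : i ≤ N) :
    ∀ (k : ℕ) (F : (Fin i → EuclideanSpace ℝ (Fin d) × ℤˣ) → EuclideanSpace ℝ (Fin d) → ℝ),
      (∀ p, IsQueryTree k (F p)) →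
      IsQueryTree (k + i) (fun a => F (A.history (linearClassifier a β) s i hi) a) := by
  induction i with
  | zero =>
    intro k F hF
    exact hF _
  | succ i ih =>
    intro k F hF
    have key := ih (Nat.le_of_succ_le hi) (k + 1)
      (fun p a => if 0 ≤ inner ℝ a (A.query ⟨i, hi⟩ p s) + β
        then F (Fin.snoc (α := fun _ => EuclideanSpace ℝ (Fin d) × ℤˣ) p
          (A.query ⟨i, hi⟩ p s, 1)) a
        else F (Fin.snoc (α := fun _ => EuclideanSpace ℝ (Fin d) × ℤˣ) p
          (A.query ⟨i, hi⟩ p s, -1)) a)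
      (fun p => .query _ _ (hF _) (hF _))
    rw [show k + (i + 1) = k + 1 + i by ring]
    convert key using 2 with a
    simp only [Auditor.history]
    conv_lhs => rw [linearClassifier]
    split_ifs <;> rfl

/-- The indicator that an auditor's estimate is at most `θ` is a query tree in the weights of
the audited linear classifier. -/
theorem isQueryTree_output_le (A : Auditor (EuclideanSpace ℝ (Fin d)) N B) (s : Fin B → Bool)
    (β θ : ℝ) :
    IsQueryTree N (fun a => if A.output (linearClassifier a β) s ≤ θ then 1 else 0) := by
  have := isQueryTree_history_bind A s β N le_rfl 0
    (fun p _ => if A.estimate p s ≤ θ then 1 else 0)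
    (fun p => .const (by split_ifs <;> norm_num) (by split_ifs <;> norm_num))
  rwa [Nat.zero_add] at this

end Auditor

/-! ### Bhattacharyya affinity -/

section Affinity

/-- Cauchy-Schwarz for the square roots of two nonnegative integrable functions. -/
theorem integral_sqrt_mul_le {α : Type*} [MeasurableSpace α] {μ : Measure α} {f g : α → ℝ}
    (hf : Integrable f μ) (hg : Integrable g μ) (hf0 : ∀ x, 0 ≤ f x) (hg0 : ∀ x, 0 ≤ g x) :
    Integrable (fun x => √(f x * g x)) μ ∧
      ∫ x, √(f x * g x) ∂μ ≤ √((∫ x, f x ∂μ) * ∫ x, g x ∂μ) := by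
  have hL : ∀ {h : α → ℝ}, Integrable h μ → (∀ x, 0 ≤ h x) →
      MemLp (fun x => √(h x)) 2 μ := fun {h} hh h0 => by
    rw [memLp_two_iff_integrable_sq (Real.continuous_sqrt.comp_aestronglyMeasurable hh.1)]
    simpa only [Real.sq_sqrt (h0 _)] using hh
  have hm : (fun x => √(f x * g x)) = fun x => √(f x) * √(g x) :=
    funext fun x => Real.sqrt_mul (hf0 x) _
  refine ⟨hm ▸ (hL hf hf0).integrable_mul (hL hg hg0), ?_⟩
  have h2 : ENNReal.ofReal 2 = 2 := by norm_num
  have := integral_mul_le_Lp_mul_Lq_of_nonneg (μ := μ) Real.HolderConjugate.two_two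
    (f := fun x => √(f x)) (g := fun x => √(g x))
    (.of_forall fun x => Real.sqrt_nonneg _) (.of_forall fun x => Real.sqrt_nonneg _)
    (h2 ▸ hL hf hf0) (h2 ▸ hL hg hg0)
  simp only [Real.rpow_two, Real.sq_sqrt (hf0 _), Real.sq_sqrt (hg0 _)] at this
  rw [hm, Real.sqrt_mul (integral_nonneg hf0), Real.sqrt_eq_rpow, Real.sqrt_eq_rpow]
  simpa only [Real.sqrt_eq_rpow] using this

/-- One step of the tensorization of the Bhattacharyya affinity. -/
theorem mul_integral_sqrt_le {α : Type*} [MeasurableSpace α] {μ : Measure α}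
    {p q F G : α → ℝ} {K : ℝ} (hp : Integrable p μ) (hq : Integrable q μ)
    (hp0 : ∀ x, 0 ≤ p x) (hq0 : ∀ x, 0 ≤ q x) (hF : Measurable F) (hG : Measurable G)
    (hF0 : ∀ x, 0 ≤ F x) (hF1 : ∀ x, F x ≤ 1) (hG0 : ∀ x, 0 ≤ G x) (hG1 : ∀ x, G x ≤ 1)
    (hK : ∀ x, K ≤ √(F x * G x) + √((1 - F x) * (1 - G x))) :
    K * ∫ x, √(p x * q x) ∂μ ≤
      √((∫ x, p x * F x ∂μ) * ∫ x, q x * G x ∂μ) +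
        √((∫ x, p x * (1 - F x) ∂μ) * ∫ x, q x * (1 - G x) ∂μ) := by
  have hint : ∀ {r H : α → ℝ}, Integrable r μ → Measurable H → (∀ x, 0 ≤ H x) →
      (∀ x, H x ≤ 1) → Integrable (fun x => r x * H x) μ := fun {r H} hr hH h0 h1 =>
    hr.mul_bdd (c := 1) hH.aestronglyMeasurable
      (.of_forall fun x => by rw [Real.norm_of_nonneg (h0 x)]; exact h1 x)
  have h1F : ∀ x, 0 ≤ 1 - F x := fun x => sub_nonneg.2 (hF1 x)
  have h1G : ∀ x, 0 ≤ 1 - G x := fun x => sub_nonneg.2 (hG1 x)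
  -- Cauchy-Schwarz is applied separately to the two outcomes; `hK` then bounds the sum of the
  -- integrands pointwise.
  have c1 := integral_sqrt_mul_le (hint hp hF hF0 hF1) (hint hq hG hG0 hG1)
    (fun x => mul_nonneg (hp0 x) (hF0 x)) (fun x => mul_nonneg (hq0 x) (hG0 x))
  have c2 := integral_sqrt_mul_le
    (hint hp (hF.const_sub 1) h1F fun x => by linarith [hF0 x])
    (hint hq (hG.const_sub 1) h1G fun x => by linarith [hG0 x])
    (fun x => mul_nonneg (hp0 x) (h1F x)) (fun x => mul_nonneg (hq0 x) (h1G x))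
  refine le_trans ?_ (add_le_add c1.2 c2.2)
  rw [← integral_add c1.1 c2.1, ← integral_const_mul]
  refine integral_mono ((integral_sqrt_mul_le hp hq hp0 hq0).1.const_mul K) (c1.1.add c2.1) ?_
  intro x
  have hpq : 0 ≤ p x * q x := mul_nonneg (hp0 x) (hq0 x)
  dsimp only [Pi.add_apply]
  rw [show p x * F x * (q x * G x) = p x * q x * (F x * G x) by ring,
    show p x * (1 - F x) * (q x * (1 - G x)) = p x * q x * ((1 - F x) * (1 - G x)) by ring,
    Real.sqrt_mul hpq, Real.sqrt_mul hpq, ← mul_add, mul_comm K]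
  exact mul_le_mul_of_nonneg_left (hK x) (Real.sqrt_nonneg _)

/-- The Bhattacharyya coefficient of two centered Gaussians. -/
theorem integral_sqrt_gaussianPDFReal_mul {σ τ : ℝ} (hσ : 0 < σ) (hτ : 0 < τ) :
    ∫ x, √(gaussianPDFReal 0 (σ ^ 2).toNNReal x * gaussianPDFReal 0 (τ ^ 2).toNNReal x) =
      √(2 * σ * τ / (σ ^ 2 + τ ^ 2)) := by
  have hpt : ∀ x, √(gaussianPDFReal 0 (σ ^ 2).toNNReal x * gaussianPDFReal 0 (τ ^ 2).toNNReal x) =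
      (√(2 * Real.pi * σ * τ))⁻¹ * Real.exp (-((σ ^ 2 + τ ^ 2) / (4 * σ ^ 2 * τ ^ 2)) * x ^ 2) := by
    intro x
    rw [Real.sqrt_eq_iff_mul_self_eq
      (mul_nonneg (gaussianPDFReal_nonneg _ _ _) (gaussianPDFReal_nonneg _ _ _)) (by positivity)]
    simp only [gaussianPDFReal, Real.coe_toNNReal _ (sq_nonneg _), sub_zero]
    have e1 : ∀ s : ℝ, 0 < s → √(2 * Real.pi * s ^ 2) = √(2 * Real.pi) * s := fun s hs => by
      rw [Real.sqrt_mul (by positivity), Real.sqrt_sq hs.le]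
    rw [e1 σ hσ, e1 τ hτ]
    rw [show ∀ a b c d : ℝ, a⁻¹ * b * (c⁻¹ * d) = (a * c)⁻¹ * (b * d) by intros; ring,
      show ∀ a b : ℝ, a⁻¹ * b * (a⁻¹ * b) = (a * a)⁻¹ * (b * b) by intros; ring,
      ← Real.exp_add, ← Real.exp_add, Real.mul_self_sqrt (by positivity),
      show √(2 * Real.pi) * σ * (√(2 * Real.pi) * τ) = √(2 * Real.pi) * √(2 * Real.pi) * σ * τ by ring,
      Real.mul_self_sqrt (by positivity)]
    congr 2
    field_simp
    ring
  simp_rw [hpt]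
  rw [integral_const_mul, integral_gaussian, ← Real.sqrt_inv, ← Real.sqrt_mul (by positivity)]
  congr 1
  field_simp
  ring

end Affinity

/-! ### Splitting a Gaussian vector along a direction -/

section Gaussian

variable {E : Type*} [NormedAddCommGroup E] [InnerProductSpace ℝ E]

/-- The orthogonal projection onto the complement of the unit vector `u`. -/
noncomputable def projCompl (u : E) : E →L[ℝ] E :=
  ContinuousLinearMap.id ℝ E - (innerSL ℝ u).smulRight u

theorem projCompl_apply (u a : E) : projCompl u a = a - inner ℝ u a • u := rfl

variable [FiniteDimensional ℝ E] [MeasurableSpace E] [BorelSpace E]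

/-- Resampling the component of a standard Gaussian vector along a unit vector. -/
theorem map_smul_add_projCompl_stdGaussian {u : E} (hu : ‖u‖ = 1) :
    ((gaussianReal 0 1).prod (stdGaussian E)).map (fun p => p.1 • u + projCompl u p.2) =
      stdGaussian E := by
  have hm : Measurable (fun p : ℝ × E => p.1 • u + projCompl u p.2) := by fun_prop
  have := Measure.isProbabilityMeasure_map (μ := (gaussianReal 0 1).prod (stdGaussian E))
    hm.aemeasurable
  apply Measure.ext_of_charFun
  ext ξ
  rw [charFun_apply, integral_map hm.aemeasurable (by fun_prop), charFun_stdGaussian]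
  have hpt : ∀ p : ℝ × E, Complex.exp (inner ℝ (p.1 • u + projCompl u p.2) ξ * Complex.I) =
      Complex.exp (inner ℝ u ξ * p.1 * Complex.I) *
        Complex.exp (inner ℝ p.2 (projCompl u ξ) * Complex.I) := by
    intro p
    rw [← Complex.exp_add]
    congr 1
    simp only [projCompl_apply, inner_add_left, inner_sub_left, inner_sub_right,
      real_inner_smul_left, real_inner_smul_right, real_inner_comm u p.2]
    push_cast
    ring
  simp_rw [hpt]
  rw [integral_prod_mul (fun t : ℝ => Complex.exp (inner ℝ u ξ * t * Complex.I))
    (fun a : E => Complex.exp (inner ℝ a (projCompl u ξ) * Complex.I)),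
    ← charFun_apply, charFun_stdGaussian, ← charFun_apply_real, charFun_gaussianReal,
    ← Complex.exp_add]
  congr 1
  -- Pythagoras: the two Gaussian exponents add up to `-‖ξ‖² / 2`.
  have hn : ‖projCompl u ξ‖ ^ 2 = ‖ξ‖ ^ 2 - inner ℝ u ξ ^ 2 := by
    rw [projCompl_apply, norm_sub_sq_real, real_inner_smul_right, norm_smul, hu,
      real_inner_comm u ξ, Real.norm_eq_abs, mul_one, sq_abs]
    ring
  rw [← Complex.ofReal_pow ‖projCompl u ξ‖, hn]
  push_cast
  ring

end Gaussian

/-! ### Affinity bound for query trees -/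

section TreeAffinity

variable {E : Type*} [NormedAddCommGroup E] [InnerProductSpace ℝ E] [FiniteDimensional ℝ E]
  [MeasurableSpace E] [BorelSpace E]

theorem IsQueryTree.integrable_comp_smul {n : ℕ} {f : E → ℝ} (hf : IsQueryTree n f) (σ : ℝ) :
    Integrable (fun a => f (σ • a)) (stdGaussian E) := by
  refine Integrable.of_bound (C := 1)
    (hf.measurable.comp (measurable_const_smul σ)).aestronglyMeasurable (.of_forall fun a => ?_)
  rw [Real.norm_of_nonneg (hf.nonneg _)]
  exact hf.le_one _

/-- The integral against a scaled standard Gaussian, computed by first fixing the component along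
a unit vector. -/
theorem integral_comp_smul_stdGaussian {u : E} (hu : ‖u‖ = 1) {f : E → ℝ} (hf : Measurable f)
    {C : ℝ} (hC : ∀ a, |f a| ≤ C) {σ : ℝ} (hσ : 0 < σ) :
    ∫ a, f (σ • a) ∂(stdGaussian E) =
      ∫ t, gaussianPDFReal 0 (σ ^ 2).toNNReal t *
        ∫ a, f (t • u + projCompl u (σ • a)) ∂(stdGaussian E) := by
  have hm : Measurable (fun p : ℝ × E => p.1 • u + projCompl u p.2) := by fun_prop
  have hfs : Measurable (fun a => f (σ • a)) := hf.comp (measurable_const_smul σ)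
  have hF : Measurable (fun p : ℝ × E => f (p.1 • u + projCompl u (σ • p.2))) :=
    hf.comp (by fun_prop)
  have hv : (σ ^ 2).toNNReal ≠ 0 := by simpa using hσ.ne'
  have hmap : (gaussianReal 0 1).map (σ * ·) = gaussianReal 0 (σ ^ 2).toNNReal := by
    rw [gaussianReal_map_const_mul, mul_zero, mul_one]
    congr 1
    ext
    simp [sq_nonneg]
  conv_lhs => rw [← map_smul_add_projCompl_stdGaussian hu]
  rw [integral_map hm.aemeasurable hfs.aestronglyMeasurable, integral_prod]
  · rw [← funext fun t => smul_eq_mul (gaussianPDFReal 0 (σ ^ 2).toNNReal t) _,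
      ← integral_gaussianReal_eq_integral_smul hv, ← hmap, integral_map (by fun_prop)
      hF.stronglyMeasurable.integral_prod_right'.aestronglyMeasurable]
    simp only [smul_add, smul_smul, map_smul]
  · exact Integrable.of_bound (C := C) (hfs.comp hm).aestronglyMeasurable
      (.of_forall fun p => hC _)

/-- Query trees of depth `n` distinguish two scalings of a standard Gaussian vector no better than
`n` independent one-dimensional observations do. -/
theorem IsQueryTree.pow_le_affinity [Nontrivial E] {σ τ : ℝ} (hσ : 0 < σ) (hτ : 0 < τ) {n : ℕ}
    {f : E → ℝ} (hf : IsQueryTree n f) :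
    √(2 * σ * τ / (σ ^ 2 + τ ^ 2)) ^ n ≤
      √((∫ a, f (σ • a) ∂(stdGaussian E)) * ∫ a, f (τ • a) ∂(stdGaussian E)) +
        √((1 - ∫ a, f (σ • a) ∂(stdGaussian E)) * (1 - ∫ a, f (τ • a) ∂(stdGaussian E))) := by
  induction n generalizing f with
  | zero =>
    cases hf with
    | @const c h0 h1 =>
      simp [Real.sqrt_mul_self h0, Real.sqrt_mul_self (sub_nonneg.2 h1)]
  | succ n ih =>
    -- With `u` along the root query, the root's answer depends on `t` alone, so each slice loses
    -- one level.
    obtain ⟨u, hu, hslice⟩ : ∃ u : E, ‖u‖ = 1 ∧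
        ∀ t : ℝ, IsQueryTree n (fun a => f (t • u + projCompl u a)) := by
      cases hf with
      | @query _ f g x b hf hg =>
        obtain ⟨u, hu, r, hx⟩ : ∃ u : E, ‖u‖ = 1 ∧ ∃ r : ℝ, x = r • u := by
          by_cases hx : x = 0
          · obtain ⟨u, hu⟩ := exists_norm_eq E zero_le_one
            exact ⟨u, hu, 0, by simp [hx]⟩
          · refine ⟨‖x‖⁻¹ • x, norm_smul_inv_norm hx, ‖x‖, ?_⟩
            rw [smul_smul, mul_inv_cancel₀ (norm_ne_zero_iff.2 hx), one_smul]
        refine ⟨u, hu, fun t => ?_⟩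
        have hin : ∀ a : E, inner ℝ (t • u + projCompl u a) x = t * r := fun a => by
          rw [hx, projCompl_apply]
          simp only [inner_add_left, inner_sub_left, real_inner_smul_left, real_inner_smul_right,
            real_inner_self_eq_norm_sq, hu, real_inner_comm u a]
          ring
        simp only [hin]
        split_ifs
        · exact hf.comp_affine _ _
        · exact hg.comp_affine _ _
    have hbound : ∀ a, |f a| ≤ 1 := fun a => by
      rw [abs_of_nonneg (hf.nonneg a)]
      exact hf.le_one a
    have hmeas : ∀ s : ℝ, Measurable
        (fun t : ℝ => ∫ a, f (t • u + projCompl u (s • a)) ∂(stdGaussian E)) := fun s =>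
      have hF : Measurable (fun p : ℝ × E => f (p.1 • u + projCompl u (s • p.2))) :=
        hf.measurable.comp (by fun_prop)
      hF.stronglyMeasurable.integral_prod_right'.measurable
    have h0 : ∀ s t : ℝ, 0 ≤ ∫ a, f (t • u + projCompl u (s • a)) ∂(stdGaussian E) := fun s t =>
      integral_nonneg fun a => hf.nonneg _
    have h1 : ∀ s t : ℝ, ∫ a, f (t • u + projCompl u (s • a)) ∂(stdGaussian E) ≤ 1 := fun s t => by
      have := integral_mono ((hslice t).integrable_comp_smul s) (integrable_const (1 : ℝ))
        (fun a => hf.le_one _)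
      simpa using this
    have hcompl : ∀ s : ℝ, 0 < s → 1 - ∫ a, f (s • a) ∂(stdGaussian E) =
        ∫ t, gaussianPDFReal 0 (s ^ 2).toNNReal t *
          (1 - ∫ a, f (t • u + projCompl u (s • a)) ∂(stdGaussian E)) := fun s hs => by
      rw [integral_comp_smul_stdGaussian hu hf.measurable hbound hs]
      simp_rw [mul_sub, mul_one]
      rw [integral_sub (integrable_gaussianPDFReal _ _),
        integral_gaussianPDFReal_eq_one _ (by simpa using hs.ne')]
      exact (integrable_gaussianPDFReal _ _).mul_bdd (c := 1) (hmeas s).aestronglyMeasurable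
        (.of_forall fun t => by rw [Real.norm_of_nonneg (h0 s t)]; exact h1 s t)
    rw [hcompl σ hσ, hcompl τ hτ, integral_comp_smul_stdGaussian hu hf.measurable hbound hσ,
      integral_comp_smul_stdGaussian hu hf.measurable hbound hτ, pow_succ,
      ← integral_sqrt_gaussianPDFReal_mul hσ hτ]
    refine mul_integral_sqrt_le (integrable_gaussianPDFReal _ _) (integrable_gaussianPDFReal _ _)
      (gaussianPDFReal_nonneg _ _) (gaussianPDFReal_nonneg _ _) (hmeas σ) (hmeas τ) (h0 σ) (h1 σ)
      (h0 τ) (h1 τ) fun t => ?_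
    rw [integral_sqrt_gaussianPDFReal_mul hσ hτ]
    exact ih (hslice t)

/-- Le Cam's two-point bound for query trees. -/
theorem IsQueryTree.two_point_bound [Nontrivial E] {σ τ : ℝ} (hσ : 0 < σ) (hτ : 0 < τ) {n : ℕ}
    {f : E → ℝ} (hf : IsQueryTree n f) :
    (1 - n * ((τ - σ) ^ 2 / (σ ^ 2 + τ ^ 2))) / 2 ≤
      (1 - ∫ a, f (σ • a) ∂(stdGaussian E)) + ∫ a, f (τ • a) ∂(stdGaussian E) := by
  have hI : ∀ s : ℝ, 0 ≤ ∫ a, f (s • a) ∂(stdGaussian E) ∧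
      ∫ a, f (s • a) ∂(stdGaussian E) ≤ 1 := fun s => by
    refine ⟨integral_nonneg fun a => hf.nonneg _, ?_⟩
    simpa using integral_mono (hf.integrable_comp_smul s) (integrable_const (1 : ℝ))
      (fun a => hf.le_one _)
  have key := hf.pow_le_affinity hσ hτ
  obtain ⟨hx0, hx1⟩ := hI σ
  obtain ⟨hy0, hy1⟩ := hI τ
  set x := ∫ a, f (σ • a) ∂(stdGaussian E)
  set y := ∫ a, f (τ • a) ∂(stdGaussian E)
  have hpos : 0 < σ ^ 2 + τ ^ 2 := by positivity
  -- The factors `x` and `1 - y` are at most `1` and are dropped. Squaring and Bernoulli's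
  -- inequality then give the bound.
  have hA : √(2 * σ * τ / (σ ^ 2 + τ ^ 2)) ^ n ≤ √y + √(1 - x) := by
    refine key.trans (add_le_add (Real.sqrt_le_sqrt ?_) (Real.sqrt_le_sqrt ?_))
    · nlinarith
    · nlinarith
  have hsq : (√(2 * σ * τ / (σ ^ 2 + τ ^ 2)) ^ n) ^ 2 =
      (1 + -((τ - σ) ^ 2 / (σ ^ 2 + τ ^ 2))) ^ n := by
    rw [← pow_mul, mul_comm n, pow_mul, Real.sq_sqrt (by positivity)]
    congr 1
    field_simp
    ring
  have hle : (τ - σ) ^ 2 / (σ ^ 2 + τ ^ 2) ≤ 1 := by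
    rw [div_le_one hpos]
    nlinarith [mul_pos hσ hτ]
  have hb := one_add_mul_le_pow (show -2 ≤ -((τ - σ) ^ 2 / (σ ^ 2 + τ ^ 2)) by linarith) n
  have h2 := pow_le_pow_left₀ (by positivity) hA 2
  nlinarith [sq_nonneg (√y - √(1 - x)), Real.sq_sqrt hy0, Real.sq_sqrt (sub_nonneg.2 hx1)]

end TreeAffinity

/-! ### Concentration of the Gaussian norm -/

section Concentration

theorem integral_pow_four_gaussianReal : ∫ x, x ^ 4 ∂(gaussianReal 0 1) = 3 := by
  rw [integral_gaussianReal_eq_integral_smul one_ne_zero]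
  have hpt : ∀ x : ℝ, gaussianPDFReal 0 1 x • x ^ 4 =
      (√(2 * Real.pi))⁻¹ * (fun y : ℝ => y ^ (4 : ℝ) * Real.exp (-(1 / 2) * y ^ (2 : ℝ))) |x| := by
    intro x
    simp only [gaussianPDFReal, smul_eq_mul, Real.rpow_two, sq_abs, NNReal.coe_one, mul_one,
      sub_zero]
    rw [show (4 : ℝ) = ((4 : ℕ) : ℝ) by norm_num, Real.rpow_natCast, Even.pow_abs ⟨2, rfl⟩]
    ring_nf
  simp_rw [hpt]
  rw [integral_const_mul, integral_comp_abs (f := fun y : ℝ =>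
      y ^ (4 : ℝ) * Real.exp (-(1 / 2) * y ^ (2 : ℝ))),
    integral_rpow_mul_exp_neg_mul_rpow two_pos (by norm_num) (by norm_num),
    show ((4 : ℝ) + 1) / 2 = 1 / 2 + 1 + 1 by norm_num, Real.Gamma_add_one (by norm_num),
    Real.Gamma_add_one (by norm_num), Real.Gamma_one_half_eq,
    show -((4 : ℝ) + 1) / 2 = -(1 / 2) - (2 : ℕ) by norm_num,
    Real.rpow_sub_natCast (by norm_num), Real.rpow_neg (by norm_num), ← Real.sqrt_eq_rpow,
    Real.sqrt_mul (by norm_num), one_div, Real.sqrt_inv]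
  have h2 : √2 ≠ 0 := by positivity
  have hpi : √Real.pi ≠ 0 := by positivity
  field_simp
  norm_num

theorem memLp_sq_gaussianReal : MemLp (fun x : ℝ => x ^ 2) 2 (gaussianReal 0 1) := by
  rw [memLp_two_iff_integrable_sq (by fun_prop)]
  have := (memLp_id_gaussianReal' (μ := 0) (v := 1) 4 (by norm_num)).integrable_norm_pow
    (p := 4) (by norm_num)
  simpa [← pow_mul, Even.pow_abs (show Even 4 by decide)] using this

theorem integral_sq_gaussianReal : ∫ x, x ^ 2 ∂(gaussianReal 0 1) = 1 := by
  have := variance_fun_id_gaussianReal (μ := 0) (v := 1)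
  rw [variance_eq_integral (by fun_prop)] at this
  simpa using this

theorem variance_sq_gaussianReal_le : Var[fun x => x ^ 2; gaussianReal 0 1] ≤ 2 := by
  rw [variance_eq_sub memLp_sq_gaussianReal]
  simp only [Pi.pow_apply, ← pow_mul, integral_sq_gaussianReal]
  rw [integral_pow_four_gaussianReal]
  norm_num

/-- Chebyshev's inequality for the squared norm of a standard Gaussian vector. -/
theorem stdGaussian_real_norm_sq_sub_ge_le (d : ℕ) {r : ℝ} (hr : 0 < r) :
    (stdGaussian (EuclideanSpace ℝ (Fin d))).real {a | r ≤ |‖a‖ ^ 2 - d|} ≤ 2 * d / r ^ 2 := by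
  have hX : ∀ i ∈ Finset.univ, MemLp (fun x : Fin d → ℝ => x i ^ 2) 2
      (Measure.pi fun _ : Fin d => gaussianReal 0 1) := fun i _ =>
    memLp_sq_gaussianReal.comp_measurePreserving (measurePreserving_eval _ i)
  have hS := memLp_finsetSum' Finset.univ hX
  have hmean : ∫ x : Fin d → ℝ, (∑ i, fun x : Fin d → ℝ => x i ^ 2) x
      ∂(Measure.pi fun _ : Fin d => gaussianReal 0 1) = d := by
    simp_rw [Finset.sum_apply]
    rw [integral_finsetSum _ fun i hi => (hX i hi).integrable (by norm_num)]
    simp_rw [integral_comp_eval (μ := fun _ : Fin d => gaussianReal 0 1) (f := fun y : ℝ => y ^ 2)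
      (memLp_sq_gaussianReal.aestronglyMeasurable), integral_sq_gaussianReal]
    simp
  have hvar : Var[∑ i, fun x : Fin d → ℝ => x i ^ 2;
      Measure.pi fun _ : Fin d => gaussianReal 0 1] ≤ 2 * d := by
    rw [variance_sum_pi (X := fun _ y => y ^ 2) fun _ => memLp_sq_gaussianReal]
    calc ∑ _i : Fin d, Var[fun y => y ^ 2; gaussianReal 0 1]
        ≤ ∑ _i : Fin d, 2 := Finset.sum_le_sum fun _ _ => variance_sq_gaussianReal_le
      _ = 2 * d := by simp [mul_comm]
  have hcheb := meas_ge_le_variance_div_sq hS hr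
  rw [hmean] at hcheb
  rw [← map_pi_eq_stdGaussian, map_measureReal_apply (by fun_prop)
    (measurableSet_le measurable_const (by fun_prop))]
  refine (ENNReal.toReal_le_of_le_ofReal
    (div_nonneg (variance_nonneg _ _) (by positivity)) ?_).trans
    (div_le_div_of_nonneg_right hvar (by positivity))
  refine le_trans (le_of_eq ?_) hcheb
  congr 1
  ext x
  simp [EuclideanSpace.real_norm_sq_eq]

end Concentration

/-! ### Parity as a function of the weight norm -/

section DemographicParity

variable {d : ℕ}

theorem measurableSet_linearClassifier_eq_one (a : EuclideanSpace ℝ (Fin d)) (b : ℝ) :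
    MeasurableSet {x | linearClassifier a b x = 1} := by
  have : {x | linearClassifier a b x = 1} = {x | 0 ≤ inner ℝ a x + b} := by
    ext x
    simp only [linearClassifier, Set.mem_ofPred_eq]
    split_ifs with h
    · simp [h]
    · simp only [h, iff_false]
      decide
  rw [this]
  exact measurableSet_le measurable_const (by fun_prop)

theorem cond_group_real_eq_groupLaw {X : Type*} [MeasurableSpace X] (D : Measure (X × Fin 2))
    (g : Fin 2) {h : Classifier X} (hh : MeasurableSet {x | h x = 1}) :
    (D[|group X g]).real {p | h p.1 = 1} = (groupLaw D g).real {x | h x = 1} := by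
  rw [groupLaw, map_measureReal_apply measurable_fst hh]
  rfl

theorem stdGaussian_map_inner (a : EuclideanSpace ℝ (Fin d)) :
    (stdGaussian (EuclideanSpace ℝ (Fin d))).map (fun x => inner ℝ a x) =
      (gaussianReal 0 1).map (‖a‖ * ·) := by
  apply Measure.ext_of_charFun
  ext t
  rw [charFun_apply_real, charFun_apply_real, integral_map (by fun_prop) (by fun_prop),
    integral_map (by fun_prop) (by fun_prop)]
  have h1 : ∀ x, Complex.exp (t * (inner ℝ a x : ℝ) * Complex.I) =
      Complex.exp ((inner ℝ x (t • a) : ℝ) * Complex.I) := fun x => by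
    rw [real_inner_smul_right, real_inner_comm a x, Complex.ofReal_mul]
  have h2 : ∀ x : ℝ, Complex.exp (t * (‖a‖ * x : ℝ) * Complex.I) =
      Complex.exp ((t * ‖a‖ : ℝ) * x * Complex.I) := fun x => by
    push_cast
    ring_nf
  simp_rw [h1, h2]
  rw [← charFun_apply, ← charFun_apply_real, charFun_stdGaussian, charFun_gaussianReal, norm_smul]
  congr 1
  simp only [Real.norm_eq_abs, NNReal.coe_one, ← Complex.ofReal_pow, mul_pow, sq_abs]
  push_cast
  ring

/-- The demographic parity of `sign (⟪a, x⟫ + 1)`. -/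
theorem demographicParity_linearClassifier_one {D : Measure (EuclideanSpace ℝ (Fin d) × Fin 2)}
    (h0 : groupLaw D 0 = multivariateGaussian 0 1) (h1 : groupLaw D 1 = multivariateGaussian 0 0)
    (a : EuclideanSpace ℝ (Fin d)) :
    demographicParity D (linearClassifier a 1) = (gaussianReal 0 1).real {t | ‖a‖ * t < -1} := by
  have hm := measurableSet_linearClassifier_eq_one a 1
  have hd : multivariateGaussian (0 : EuclideanSpace ℝ (Fin d)) (0 : Matrix (Fin d) (Fin d) ℝ) =
      Measure.dirac 0 := by
    simp [multivariateGaussian]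
  -- The bias `1` labels the origin `+1` whatever `a` is.
  have hdirac : (Measure.dirac (0 : EuclideanSpace ℝ (Fin d))).real
      {x | linearClassifier a 1 x = 1} = 1 := by
    rw [measureReal_def, Measure.dirac_apply' _ hm]
    simp [linearClassifier]
  rw [demographicParity, cond_group_real_eq_groupLaw D 1 hm, cond_group_real_eq_groupLaw D 0 hm,
    h0, h1, multivariateGaussian_zero_one, hd, hdirac, ← probReal_compl_eq_one_sub hm]
  have hset : {x | linearClassifier a 1 x = 1}ᶜ = (fun x => inner ℝ a x) ⁻¹' Set.Iio (-1) := by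
    ext x
    simp only [linearClassifier, Set.mem_compl_iff, Set.mem_ofPred_eq, Set.mem_preimage,
      Set.mem_Iio]
    split_ifs with h
    · simp only [not_true_eq_false, false_iff, not_lt]
      linarith
    · simp only [show (-1 : ℤˣ) ≠ 1 by decide, not_false_eq_true, true_iff]
      linarith
  rw [hset, ← map_measureReal_apply (by fun_prop) measurableSet_Iio, stdGaussian_map_inner,
    map_measureReal_apply (by fun_prop) measurableSet_Iio]
  rfl

/-- This and the next lemma turn bounds on `‖a‖` into bounds on the parity, which increases with
`‖a‖`. -/
theorem gaussianReal_real_mul_lt_le {r : ℝ} (hr0 : 0 ≤ r) (hr : r ≤ 1) :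
    (gaussianReal 0 1).real {t | r * t < -1} ≤ (gaussianReal 0 1).real (Set.Iio (-1)) := by
  refine measureReal_mono fun t ht => ?_
  simp only [Set.mem_ofPred_eq, Set.mem_Iio] at ht ⊢
  by_contra! hc
  nlinarith

theorem le_gaussianReal_real_mul_lt {r κ : ℝ} (hκ : 0 < κ) (h : 1 ≤ r * κ) :
    (gaussianReal 0 1).real (Set.Iio (-κ)) ≤ (gaussianReal 0 1).real {t | r * t < -1} := by
  refine measureReal_mono fun t ht => ?_
  simp only [Set.mem_ofPred_eq, Set.mem_Iio] at ht ⊢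
  have : 0 < r := by
    by_contra! hc
    nlinarith
  nlinarith

/-- The standard Gaussian density exceeds `1 / 5` on `[-1, 1]`. -/
theorem gaussianReal_real_Iio_gap {δ : ℝ} (hδ : 0 < δ) (hδ1 : δ ≤ 1) :
    (gaussianReal 0 1).real (Set.Iio (-1)) + δ / 5 <
      (gaussianReal 0 1).real (Set.Iio (-(1 - δ))) := by
  have hsplit : (gaussianReal 0 1).real (Set.Iio (-(1 - δ))) =
      (gaussianReal 0 1).real (Set.Iio (-1)) + (gaussianReal 0 1).real (Set.Ico (-1) (-(1 - δ))) := by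
    rw [← measureReal_union _ measurableSet_Ico, Set.Iio_union_Ico_eq_Iio (by linarith)]
    exact Set.disjoint_left.2 fun t h1 h2 => (not_le.2 h1) h2.1
  -- Here `exp (-1/2) ≥ (3/4)²` and `√(2π) ≤ 2.51`; the excess of `11/50` over `1/5` makes the gap
  -- strict.
  have hpdf : ∀ t ∈ Set.Ico (-1 : ℝ) (-(1 - δ)), 11 / 50 ≤ gaussianPDFReal 0 1 t := by
    intro t ht
    have h1 : Real.exp (-(1 / 2)) ≤ Real.exp (-(t - 0) ^ 2 / (2 * ((1 : NNReal) : ℝ))) := by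
      rw [Real.exp_le_exp]
      have := ht.1
      have := ht.2
      rw [NNReal.coe_one]
      nlinarith
    have h2 : √(2 * Real.pi * ((1 : NNReal) : ℝ)) ≤ 2.51 := by
      rw [Real.sqrt_le_left (by norm_num), NNReal.coe_one]
      nlinarith [Real.pi_lt_d4]
    have h3 : (9 / 16 : ℝ) ≤ Real.exp (-(1 / 2)) := by
      rw [show (-(1 / 2) : ℝ) = -(1 / 4) + -(1 / 4) by norm_num, Real.exp_add]
      nlinarith [Real.add_one_le_exp (-(1 / 4) : ℝ)]
    rw [gaussianPDFReal, inv_mul_eq_div, le_div_iff₀ (by positivity)]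
    linarith
  rw [hsplit]
  have hint : 11 / 50 * δ ≤ (gaussianReal 0 1).real (Set.Ico (-1) (-(1 - δ))) := by
    rw [measureReal_def, gaussianReal_apply_eq_integral _ one_ne_zero,
      ENNReal.toReal_ofReal (integral_nonneg fun t => gaussianPDFReal_nonneg _ _ _)]
    have := setIntegral_mono_on (μ := volume) (s := Set.Ico (-1 : ℝ) (-(1 - δ)))
      (f := fun _ => (11 / 50 : ℝ)) (by simp) (integrable_gaussianPDFReal 0 1).integrableOn
      measurableSet_Ico hpdf
    refine le_trans (le_of_eq ?_) this
    simp [Real.volume_real_Ico, hδ.le, mul_comm]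
  linarith

end DemographicParity

/-! ### Two priors and the contradiction -/

section LowerBound

variable {d N B : ℕ}

instance (B : ℕ) : IsProbabilityMeasure (seedLaw B) :=
  inferInstanceAs (IsProbabilityMeasure (uniformOn Set.univ))

theorem sum_seedLaw_real_mul_indicator (S : Set (Fin B → Bool)) [DecidablePred (· ∈ S)] :
    ∑ s, (seedLaw B).real {s} * (if s ∈ S then 1 else 0) = (seedLaw B).real S := by
  have h := integral_fintype (μ := seedLaw B) (f := S.indicator fun _ => (1 : ℝ))
    (Integrable.of_finite)
  rw [integral_indicator_const _ (Set.toFinite S).measurableSet] at h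
  simpa [Set.indicator_apply] using h.symm

theorem sum_seedLaw_real_singleton : ∑ s, (seedLaw B).real {s} = 1 := by
  classical
  simp

/-- Averaging a pointwise bound on the error over the seed and over the weights of the
classifier. -/
theorem sum_seedLaw_real_mul_integral_le (E : Set (EuclideanSpace ℝ (Fin d)))
    (hE : MeasurableSet E) (S : EuclideanSpace ℝ (Fin d) → Set (Fin B → Bool)) {p : ℝ}
    (hS : ∀ a, (seedLaw B).real (S a) ≤ p)
    (f : (Fin B → Bool) → EuclideanSpace ℝ (Fin d) → ℝ)
    (hf : ∀ s, Integrable (f s) (stdGaussian (EuclideanSpace ℝ (Fin d))))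
    (hf1 : ∀ s a, f s a ≤ 1) (hfS : ∀ s a, a ∉ E → s ∉ S a → f s a = 0) :
    ∑ s, (seedLaw B).real {s} * ∫ a, f s a ∂(stdGaussian (EuclideanSpace ℝ (Fin d))) ≤
      p + (stdGaussian (EuclideanSpace ℝ (Fin d))).real E := by
  classical
  have hp : 0 ≤ p := measureReal_nonneg.trans (hS 0)
  simp_rw [← integral_const_mul]
  rw [← integral_finsetSum _ fun s _ => (hf s).const_mul _]
  have hpt : ∀ a, ∑ s, (seedLaw B).real {s} * f s a ≤ p + E.indicator (fun _ => 1) a := by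
    intro a
    by_cases ha : a ∈ E
    · rw [Set.indicator_of_mem ha]
      calc ∑ s, (seedLaw B).real {s} * f s a ≤ ∑ s, (seedLaw B).real {s} := by
            refine Finset.sum_le_sum fun s _ => ?_
            exact mul_le_of_le_one_right measureReal_nonneg (hf1 s a)
        _ = 1 := sum_seedLaw_real_singleton
        _ ≤ p + 1 := by linarith
    · rw [Set.indicator_of_notMem ha, add_zero]
      refine le_trans ?_ (hS a)
      rw [← sum_seedLaw_real_mul_indicator]
      refine Finset.sum_le_sum fun s _ => mul_le_mul_of_nonneg_left ?_ measureReal_nonneg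
      split_ifs with hs
      · exact hf1 s a
      · exact (hfS s a ha hs).le
  have hind : Integrable (E.indicator fun _ => (1 : ℝ))
      (stdGaussian (EuclideanSpace ℝ (Fin d))) := (integrable_const 1).indicator hE
  refine (integral_mono (integrable_finsetSum _ fun s _ => (hf s).const_mul _)
    ((integrable_const p).add hind) hpt).trans (le_of_eq ?_)
  rw [integral_add' (integrable_const p) hind, integral_indicator_const _ hE]
  simp

/-- Two priors with separated demographic parities: if every classifier were audited well, then so
would a random one, and the auditor would tell the two scales of its weights apart. -/
theorem exists_seedLaw_real_error_gt {D : Measure (EuclideanSpace ℝ (Fin d) × Fin 2)}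
    (h0 : groupLaw D 0 = multivariateGaussian 0 1) (h1 : groupLaw D 1 = multivariateGaussian 0 0)
    (A : Auditor (EuclideanSpace ℝ (Fin d)) N B) {ε e : ℝ} (hd : 0 < d) (he : 0 < e)
    (hεe : ε ≤ e) (he80 : e ≤ 1 / 80) (hde : 1 ≤ d * e ^ 2) (hN : N * e ^ 2 ≤ 1 / 25000) :
    ∃ a : EuclideanSpace ℝ (Fin d), 1 / 8 < (seedLaw B).real
      {s | ε < |A.output (linearClassifier a 1) s -
        demographicParity D (linearClassifier a 1)|} := by
  classical
  by_contra! hcon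
  have : Nonempty (Fin d) := ⟨⟨0, hd⟩⟩
  have hd' : (0 : ℝ) < d := by exact_mod_cast hd
  simp_rw [demographicParity_linearClassifier_one h0 h1] at hcon
  set M := (gaussianReal 0 1).real (Set.Iio (-1)) with hM
  -- `δ = 10 e` makes the parity gap exceed `2 e ≥ 2 ε`, so the threshold `M + ε` separates accurate
  -- outputs.
  have hgap := gaussianReal_real_Iio_gap (δ := 10 * e) (by positivity) (by linarith)
  rw [← hM] at hgap
  set M' := (gaussianReal 0 1).real (Set.Iio (-(1 - 10 * e))) with hM'
  -- When `‖a‖²` is within `5 e d` of `d`, these scales give `‖σ • a‖ ≤ 1` and `‖τ • a‖ ≥ 1 / (1 -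
  -- 10 e)`.
  set σ := √(1 / (d * (1 + 5 * e))) with hσ
  set τ := √(1 / (d * (1 - 5 * e) * (1 - 10 * e) ^ 2)) with hτ
  have hp1 : 0 < 1 - 5 * e := by linarith
  have hp2 : 0 < 1 - 10 * e := by linarith
  have hσ0 : 0 < σ := by positivity
  have hτ0 : 0 < τ := by positivity
  have hσ2 : σ ^ 2 = 1 / (d * (1 + 5 * e)) := Real.sq_sqrt (by positivity)
  have hτ2 : τ ^ 2 = 1 / (d * (1 - 5 * e) * (1 - 10 * e) ^ 2) := Real.sq_sqrt (by positivity)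
  let f : (Fin B → Bool) → EuclideanSpace ℝ (Fin d) → ℝ := fun s a =>
    if A.output (linearClassifier a 1) s ≤ M + ε then 1 else 0
  have hf : ∀ s, IsQueryTree N (f s) := fun s => isQueryTree_output_le A s 1 (M + ε)
  have hΔ : (N : ℝ) * ((τ - σ) ^ 2 / (σ ^ 2 + τ ^ 2)) ≤ 1 / 10 := by
    have hratio : τ ^ 2 ≤ (1 + 50 * e) ^ 2 * σ ^ 2 := by
      rw [hσ2, hτ2, mul_one_div, div_le_div_iff₀ (by positivity) (by positivity)]
      have hpoly : 1 + 5 * e ≤ (1 + 50 * e) ^ 2 * ((1 - 5 * e) * (1 - 10 * e) ^ 2) := by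
        have e1 : 1 - 25 * e ≤ (1 - 5 * e) * (1 - 10 * e) ^ 2 := by nlinarith [pow_pos he 3]
        have e2 : 1 + 100 * e ≤ (1 + 50 * e) ^ 2 := by nlinarith
        have e3 := mul_le_mul e2 e1 (by linarith) (by positivity)
        nlinarith
      nlinarith [mul_le_mul_of_nonneg_left hpoly hd'.le]
    have hστ : σ ≤ τ := by
      refine Real.sqrt_le_sqrt (one_div_le_one_div_of_le (by positivity) ?_)
      have : (1 - 10 * e) ^ 2 ≤ 1 := by nlinarith
      nlinarith [mul_le_mul_of_nonneg_left this (mul_pos hd' hp1).le, mul_pos hd' he]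
    have hle : τ ≤ (1 + 50 * e) * σ := by
      rw [← mul_pow] at hratio
      exact le_of_sq_le_sq hratio (by positivity)
    have hdiff : (τ - σ) ^ 2 / (σ ^ 2 + τ ^ 2) ≤ 2500 * e ^ 2 := by
      rw [div_le_iff₀ (by positivity)]
      have : (τ - σ) ^ 2 ≤ (50 * e * σ) ^ 2 :=
        pow_le_pow_left₀ (by linarith) (by linarith) 2
      nlinarith [mul_pos (sq_pos_of_pos he) (sq_pos_of_pos hτ0)]
    calc (N : ℝ) * ((τ - σ) ^ 2 / (σ ^ 2 + τ ^ 2)) ≤ N * (2500 * e ^ 2) := by gcongr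
      _ ≤ 1 / 10 := by linarith
  have htwo : ∀ s, 9 / 20 ≤
      (∫ a, (1 - f s (σ • a)) ∂(stdGaussian (EuclideanSpace ℝ (Fin d)))) +
        ∫ a, f s (τ • a) ∂(stdGaussian (EuclideanSpace ℝ (Fin d))) := fun s => by
    have := (hf s).two_point_bound hσ0 hτ0
    rw [integral_sub (integrable_const 1) ((hf s).integrable_comp_smul σ)]
    simp only [integral_const, probReal_univ, smul_eq_mul, mul_one]
    linarith
  -- Chebyshev gives `2 / (25 d e²)`, which is where `1 ≤ d e²` enters.
  have hcheb : (stdGaussian (EuclideanSpace ℝ (Fin d))).real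
      {a | 5 * e * d ≤ |‖a‖ ^ 2 - d|} ≤ 2 / 25 := by
    refine (stdGaussian_real_norm_sq_sub_ge_le d (by positivity)).trans ?_
    rw [div_le_div_iff₀ (by positivity) (by norm_num)]
    nlinarith [mul_le_mul_of_nonneg_left hde hd'.le]
  have hEm : MeasurableSet {a : EuclideanSpace ℝ (Fin d) | 5 * e * d ≤ |‖a‖ ^ 2 - d|} :=
    measurableSet_le measurable_const (by fun_prop)
  have hlow := sum_seedLaw_real_mul_integral_le _ hEm _ (fun a => hcon (σ • a))
    (fun s a => 1 - f s (σ • a))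
    (fun s => (integrable_const 1).sub ((hf s).integrable_comp_smul σ))
    (fun s a => sub_le_self _ ((hf s).nonneg _))
    (fun s a haE hs => by
      simp only [Set.mem_ofPred_eq, not_le, not_lt] at haE hs
      have hnorm : ‖σ • a‖ ≤ 1 := by
        rw [← sq_le_one_iff₀ (norm_nonneg _), norm_smul, mul_pow, Real.norm_eq_abs, sq_abs, hσ2,
          one_div_mul_eq_div, div_le_one (by positivity)]
        linarith [(abs_lt.1 haE).2]
      have := gaussianReal_real_mul_lt_le (norm_nonneg _) hnorm
      have hout : A.output (linearClassifier (σ • a) 1) s ≤ M + ε := by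
        linarith [(abs_le.1 hs).2]
      simp [f, hout])
  have hhigh := sum_seedLaw_real_mul_integral_le _ hEm _ (fun a => hcon (τ • a))
    (fun s a => f s (τ • a)) (fun s => (hf s).integrable_comp_smul τ)
    (fun s a => (hf s).le_one _)
    (fun s a haE hs => by
      simp only [Set.mem_ofPred_eq, not_le, not_lt] at haE hs
      have hnorm : 1 ≤ ‖τ • a‖ * (1 - 10 * e) := by
        rw [← one_le_sq_iff₀ (by positivity), norm_smul, mul_pow, mul_pow, Real.norm_eq_abs,
          sq_abs, hτ2, one_div_mul_eq_div, div_mul_eq_mul_div, le_div_iff₀ (by positivity),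
          one_mul]
        refine mul_le_mul_of_nonneg_right ?_ (sq_nonneg _)
        linarith [(abs_lt.1 haE).1]
      have := le_gaussianReal_real_mul_lt hp2 hnorm
      have hout : ¬ A.output (linearClassifier (τ • a) 1) s ≤ M + ε := by
        rw [not_le]
        linarith [(abs_le.1 hs).1]
      simp [f, hout])
  have hsum : (9 / 20 : ℝ) ≤ ∑ s, (seedLaw B).real {s} *
      ((∫ a, (1 - f s (σ • a)) ∂(stdGaussian (EuclideanSpace ℝ (Fin d)))) +
        ∫ a, f s (τ • a) ∂(stdGaussian (EuclideanSpace ℝ (Fin d)))) := by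
    calc (9 / 20 : ℝ) = ∑ s, (seedLaw B).real {s} * (9 / 20) := by
          rw [← Finset.sum_mul, sum_seedLaw_real_singleton, one_mul]
      _ ≤ _ := Finset.sum_le_sum fun s _ => mul_le_mul_of_nonneg_left (htwo s) measureReal_nonneg
  simp_rw [mul_add, Finset.sum_add_distrib] at hsum
  -- `9/20` exceeds `2 (1/8 + 2/25) = 41/100`.
  linarith

end LowerBound

end FairAudit

theorem mainTheorem5 :
    ∃ c : ℝ, 0 < c ∧
      ∀ (d : ℕ) (ε : ℝ), 6400 ≤ d → 0 < ε → ε ≤ 1 / 80 →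
      ∀ D : Measure (EuclideanSpace ℝ (Fin d) × Fin 2), IsProbabilityMeasure D →
        FairAudit.groupLaw D 0 = multivariateGaussian 0 1 →
        FairAudit.groupLaw D 1 = multivariateGaussian 0 0 →
      ∀ N : ℕ, (N : ℝ) ≤ c * min (d : ℝ) (1 / ε ^ 2) →
      ∀ (B : ℕ) (A : FairAudit.Auditor (EuclideanSpace ℝ (Fin d)) N B),
        ∃ h ∈ FairAudit.linearClass d,
          1 / 8 < (FairAudit.seedLaw B).real
            {s | ε < |A.output h s - FairAudit.demographicParity D h|} := by
  refine ⟨1 / 25000, by norm_num, fun d ε hd hε hε80 D _ h0 h1 N hN B A => ?_⟩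
  have hd' : (6400 : ℝ) ≤ d := by exact_mod_cast hd
  have hdpos : (0 : ℝ) < d := by linarith
  have hsd : (80 : ℝ) ≤ √d := Real.le_sqrt_of_sq_le (by linarith)
  have hinv : (1 / √d) ^ 2 = 1 / d := by rw [div_pow, Real.sq_sqrt hdpos.le, one_pow]
  have hN1 : (N : ℝ) ≤ 1 / 25000 * d :=
    hN.trans (mul_le_mul_of_nonneg_left (min_le_left _ _) (by norm_num))
  have hN2 : (N : ℝ) ≤ 1 / 25000 * (1 / ε ^ 2) :=
    hN.trans (mul_le_mul_of_nonneg_left (min_le_right _ _) (by norm_num))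
  -- The relative fluctuation of `‖a‖²` is of order `1/√d`, so the scales must differ by at least
  -- that much even for smaller `ε`; `d ≥ 6400` keeps `1/√d ≤ 1/80`.
  obtain ⟨a, ha⟩ := FairAudit.exists_seedLaw_real_error_gt h0 h1 A (ε := ε) (e := max ε (1 / √d))
    (by omega) (lt_max_of_lt_left hε) (le_max_left _ _)
    (max_le hε80 (one_div_le_one_div_of_le (by norm_num) hsd))
    (by
      have : (1 / √d) ^ 2 ≤ max ε (1 / √d) ^ 2 :=
        pow_le_pow_left₀ (by positivity) (le_max_right _ _) 2
      rw [hinv, div_le_iff₀ hdpos] at this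
      linarith)
    (by
      rcases max_choice ε (1 / √d) with h | h <;> rw [h]
      · rwa [mul_one_div, le_div_iff₀ (by positivity)] at hN2
      · rwa [hinv, mul_one_div, div_le_iff₀ hdpos])
  exact ⟨_, ⟨a, 1, rfl⟩, ha⟩
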